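/- **Theorem (a Bayes' theorem for matrix algebras).** Write $\mathcal M_k=\mathcal M_k(\mathbb C)$, let $\dagger$ be the conjugate transpose, and let CPU mean completely positive and unital. Let $F:\mathcal M_n\to\mathcal M_m$ be a CPU map, let $\rho\in\mathcal M_m$ be a density matrix, $\omega=\mathrm{tr}(\rho\,\cdot\,)$ the associated state on $\mathcal M_m$, and $\xi:=\omega\circ F$. Let $\sigma\in\mathcal M_n$ be the density matrix with $\xi=\mathrm{tr}(\sigma\,\cdot\,)$, let $P_\xi$ be the support of $\xi$ (the smallest orthogonal projection $P$ with $\xi(B)=\xi(PB)=\xi(BP)=\xi(PBP)$ for all $B\in\mathcal M_n$), and $P_\xi^\perp:=\mathbb 1_n-P_\xi$. Let $F^*:\mathcal M_m\to\mathcal M_n$ be the linear map determined by $\mathrm{tr}(F^*(A)B)=\mathrm{tr}(AF(B))$ for all $A\in\mathcal M_m$, $B\in\mathcal M_n$, let $\hat X$ denote the Moore–Penrose pseudoinverse of a square matrix $X$, let $E_{ij}\in\mathcal M_m$ be the matrix units, and let $\mathrm{tr}_{\mathcal M_m}:\mathcal M_m\otimes\mathcal M_n\to\mathcal M_n$ be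 the partial trace, $\mathrm{tr}_{\mathcal M_m}(A\otimes B)=\mathrm{tr}(A)B$. A *Bayesian inverse* of $(F,\omega)$ is a CPU map $G:\mathcal M_m\to\mathcal M_n$ such that $\xi(G(A)B)=\omega(AF(B))$ for all $A\in\mathcal M_m$, $B\in\mathcal M_n$. Set $$\mathfrak A:=\sum_{i,j=1}^m E_{ij}\otimes\hat\sigma F^*(\rho E_{ij})P_\xi,\qquad \mathfrak B:=\sum_{i,j=1}^m E_{ij}\otimes\hat\sigma F^*(\rho E_{ij})P_\xi^\perp$$ in $\mathcal M_m\otimes\mathcal M_n$. Then: 1. $(F,\omega)$ has a Bayesian inverse if and only if $$\mathfrak A^\dagger=\mathfrak A\qquad\text{and}\qquad \mathrm{tr}_{\mathcal M_m}\big(\mathfrak B^\dagger\hat{\mathfrak A}\mathfrak B\big)\le P_\xi^\perp,$$ where $X\le Y$ means that $Y-X$ is positive semidefinite. 2. If $\mathfrak A^\dagger=\mathfrak A$ and $\mathrm{tr}_{\mathcal M_m}(\mathfrak B^\dagger\hat{\mathfrak A}\mathfrak B)=P_\xi^\perp$, then $(F,\omega)$ has exactly one Bayesian inverse. 3. In general,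 any two Bayesian inverses $G,G'$ of $(F,\omega)$ are $\xi$-a.e. equivalent: $\xi(BG(A))=\xi(BG'(A))$ for all $A\in\mathcal M_m$, $B\in\mathcal M_n$. -/

import Mathlib

open scoped MatrixOrder ComplexOrder Kronecker Matrix

namespace MatrixBayes

open Matrix

/-! ### Completely positive unital maps and states -/

/-- A linear map of matrix algebras is completely positive if it underlies a completely positive
map of C⋆-algebras, i.e. `id ⊗ φ : M_k ⊗ M_n → M_k ⊗ M_m` is positive for all `k`; the norm that
makes `M_n(ℂ)` a C⋆-algebra is the operator norm. -/
def IsCompletelyPositive {m n : ℕ}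
    (φ : Matrix (Fin n) (Fin n) ℂ →ₗ[ℂ] Matrix (Fin m) (Fin m) ℂ) : Prop :=
  open scoped Matrix.Norms.L2Operator in
  ∃ Φ : CompletelyPositiveMap (Matrix (Fin n) (Fin n) ℂ) (Matrix (Fin m) (Fin m) ℂ),
    Φ.toLinearMap = φ

section
open scoped Matrix.Norms.L2Operator

theorem cstar_nonneg_iff {A : Type*} [NonUnitalCStarAlgebra A] [PartialOrder A]
    [StarOrderedRing A] (a : A) : 0 ≤ a ↔ ∃ b, a = star b * b :=
  CStarAlgebra.nonneg_iff_eq_star_mul_self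

theorem cstarMatrix_nonneg_iff {k n : ℕ}
    (M : CStarMatrix (Fin k) (Fin k) (Matrix (Fin n) (Fin n) ℂ)) :
    0 ≤ M ↔ (Matrix.comp _ _ _ _ _ (CStarMatrix.ofMatrix.symm M)).PosSemidef := by
  rw [cstar_nonneg_iff, ← Matrix.nonneg_iff_posSemidef,
    cstar_nonneg_iff]
  constructor
  · rintro ⟨b, rfl⟩
    refine ⟨Matrix.comp _ _ _ _ _ (CStarMatrix.ofMatrix.symm b), ?_⟩
    have := (Matrix.compRingEquiv (Fin k) (Fin n) ℂ).map_mul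
      (CStarMatrix.ofMatrix.symm (star b)) (CStarMatrix.ofMatrix.symm b)
    exact this
  · rintro ⟨b, hb⟩
    refine ⟨CStarMatrix.ofMatrix ((Matrix.comp _ _ _ _ _).symm b), ?_⟩
    apply CStarMatrix.ofMatrix.symm.injective
    apply (Matrix.comp _ _ _ _ _).injective
    rw [hb]
    have := (Matrix.compRingEquiv (Fin k) (Fin n) ℂ).symm.map_mul (star b) b
    apply (Matrix.comp _ _ _ _ _).symm.injective
    exact this
/-- Complete positivity in terms of positive semidefinite block matrices: an element `M` of
`M_k(M_n(ℂ))` is viewed as a `kn × kn` matrix, and `M.map φ` is `(id ⊗ φ)(M)`. -/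
theorem isCompletelyPositive_iff {m n : ℕ}
    (φ : Matrix (Fin n) (Fin n) ℂ →ₗ[ℂ] Matrix (Fin m) (Fin m) ℂ) :
    IsCompletelyPositive φ ↔
      ∀ (k : ℕ) (M : Matrix (Fin k) (Fin k) (Matrix (Fin n) (Fin n) ℂ)),
        (Matrix.comp _ _ _ _ _ M).PosSemidef →
          (Matrix.comp _ _ _ _ _ (M.map φ)).PosSemidef := by
  constructor
  · rintro ⟨Φ, rfl⟩ k M hM
    exact (cstarMatrix_nonneg_iff _).1
      (Φ.map_cstarMatrix_nonneg' k (CStarMatrix.ofMatrix M) ((cstarMatrix_nonneg_iff _).2 hM))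
  · intro h
    exact ⟨⟨φ, fun k M hM => (cstarMatrix_nonneg_iff _).2
      (h k (CStarMatrix.ofMatrix.symm M) ((cstarMatrix_nonneg_iff _).1 hM))⟩, rfl⟩

end

/-- Completely positive and unital. -/
structure IsCPU {m n : ℕ}
    (φ : Matrix (Fin n) (Fin n) ℂ →ₗ[ℂ] Matrix (Fin m) (Fin m) ℂ) : Prop where
  completelyPositive : IsCompletelyPositive φ
  map_one : φ 1 = 1

/-- Density matrices. -/
structure IsDensityMatrix {m : ℕ} (ρ : Matrix (Fin m) (Fin m) ℂ) : Prop where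
  posSemidef : ρ.PosSemidef
  trace_eq_one : ρ.trace = 1

/-- The functional `tr(ρ ·)`. -/
def traceFunctional {m : ℕ} (ρ : Matrix (Fin m) (Fin m) ℂ) : Matrix (Fin m) (Fin m) ℂ →ₗ[ℂ] ℂ :=
  Matrix.traceLinearMap (Fin m) ℂ ℂ ∘ₗ LinearMap.mulLeft ℂ ρ

/-! ### The pseudoinverse -/

/-- The four Penrose equations: `X` is the Moore-Penrose pseudoinverse of `A`. -/
structure IsMoorePenroseInverse {ι : Type*} [Fintype ι] (A X : Matrix ι ι ℂ) : Prop where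
  mul_mul_self : A * X * A = A
  self_mul_mul : X * A * X = X
  left_isHermitian : (A * X).IsHermitian
  right_isHermitian : (X * A).IsHermitian

theorem IsMoorePenroseInverse.unique {ι : Type*} [Fintype ι] {A X Y : Matrix ι ι ℂ}
    (hX : IsMoorePenroseInverse A X) (hY : IsMoorePenroseInverse A Y) : X = Y := by
  have h1 : A * X = A * Y := by
    calc A * X = (A * Y * A) * X := by rw [hY.1]
      _ = (A * Y) * (A * X) := by simp only [Matrix.mul_assoc]
      _ = (A * Y)ᴴ * (A * X)ᴴ := by rw [hY.3.eq, hX.3.eq]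
      _ = (A * X * A * Y)ᴴ := by rw [← conjTranspose_mul]; simp only [Matrix.mul_assoc]
      _ = A * Y := by rw [hX.1, hY.3.eq]
  have h2 : X * A = Y * A := by
    calc X * A = X * (A * Y * A) := by rw [hY.1]
      _ = (X * A) * (Y * A) := by simp only [Matrix.mul_assoc]
      _ = (X * A)ᴴ * (Y * A)ᴴ := by rw [hY.4.eq, hX.4.eq]
      _ = (Y * (A * X * A))ᴴ := by rw [← conjTranspose_mul]; simp only [Matrix.mul_assoc]
      _ = Y * A := by rw [hX.1, hY.4.eq]
  calc X = X * A * X := hX.2.symm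
    _ = Y * A * X := by rw [h2]
    _ = Y * A * Y := by rw [Matrix.mul_assoc, h1, ← Matrix.mul_assoc]
    _ = Y := hY.2

theorem exists_isMoorePenroseInverse {ι : Type*} [Fintype ι] (A : Matrix ι ι ℂ) :
    ∃ X, IsMoorePenroseInverse A X := by
  classical
  have hH : IsSelfAdjoint (Aᴴ * A) := isHermitian_conjTranspose_mul_self A
  set H := Aᴴ * A with hHdef
  have hc : ∀ f : ℝ → ℝ, ContinuousOn f (spectrum ℝ H) :=
    fun f => (Matrix.finite_real_spectrum (A := H)).continuousOn f
  have hid : H = cfc (fun x : ℝ => x) H := (cfc_id' ℝ H).symm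
  set Q := cfc (fun x : ℝ => x⁻¹) H with hQ
  have hQsa : Qᴴ = Q := (cfc_predicate (fun x : ℝ => x⁻¹) H : IsSelfAdjoint _)
  have hHsa : Hᴴ = H := hH
  have hHQ : H * Q = cfc (fun x : ℝ => x * x⁻¹) H := by
    rw [cfc_mul (fun x : ℝ => x) (fun x : ℝ => x⁻¹) H (hc _) (hc _), ← hid]
  have hQH : Q * H = cfc (fun x : ℝ => x⁻¹ * x) H := by
    rw [cfc_mul (fun x : ℝ => x⁻¹) (fun x : ℝ => x) H (hc _) (hc _), ← hid]
  have hcomm : Q * H = H * Q := by simp only [hQH, hHQ, mul_comm]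
  have hHQH : H * Q * H = H := by
    have := cfc_mul (fun x : ℝ => x * x⁻¹) (fun x : ℝ => x) H (hc _) (hc _)
    simp only [mul_inv_mul_cancel] at this
    rw [hHQ]; nth_rw 2 [hid]; rw [← this, ← hid]
  have hQHQ : Q * H * Q = Q := by
    have := cfc_mul (fun x : ℝ => x⁻¹ * x) (fun x : ℝ => x⁻¹) H (hc _) (hc _)
    have h0 : ∀ x : ℝ, x⁻¹ * x * x⁻¹ = x⁻¹ := fun x => by
      by_cases h : x = 0 <;> simp [h]
    simp only [h0] at this
    rw [hQH]; exact this.symm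
  have hAQH : A * (Q * H) = A := by
    have : A * (Q * H) - A = 0 := by
      apply Matrix.conjTranspose_mul_self_eq_zero.1
      have e : (A * (Q * H) - A)ᴴ * (A * (Q * H) - A)
          = (H * Q * H) * (Q * H) - H * Q * H - (H * (Q * H)) + H := by
        simp only [conjTranspose_sub, conjTranspose_mul, hQsa, hHdef,
          conjTranspose_conjTranspose]
        noncomm_ring
      rw [e, hHQH, ← Matrix.mul_assoc, hHQH]; simp
    exact sub_eq_zero.1 this
  refine ⟨Q * Aᴴ, ?_, ?_, ?_, ?_⟩
  · calc A * (Q * Aᴴ) * A = A * (Q * H) := by simp only [hHdef, Matrix.mul_assoc]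
      _ = A := hAQH
  · calc Q * Aᴴ * A * (Q * Aᴴ) = (Q * H * Q) * Aᴴ := by simp only [hHdef, Matrix.mul_assoc]
      _ = Q * Aᴴ := by rw [hQHQ]
  · simp [IsHermitian, conjTranspose_mul, hQsa, Matrix.mul_assoc]
  · have : Q * Aᴴ * A = Q * H := by rw [hHdef, Matrix.mul_assoc]
    rw [this, IsHermitian, conjTranspose_mul, hQsa, hHsa, hcomm]

/-- The (Moore-Penrose) pseudoinverse of a square matrix. -/
noncomputable def pinv {ι : Type*} [Fintype ι] (A : Matrix ι ι ℂ) : Matrix ι ι ℂ :=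
  Classical.choose (exists_isMoorePenroseInverse A)

theorem pinv_spec {ι : Type*} [Fintype ι] (A : Matrix ι ι ℂ) : IsMoorePenroseInverse A (pinv A) :=
  Classical.choose_spec (exists_isMoorePenroseInverse A)

/-! ### The support of a functional, and the Hilbert-Schmidt dual of a map -/

/-- The unique matrix `σ` with `ξ = tr(σ ·)`. -/
def densityMatrix {n : ℕ} (ξ : Matrix (Fin n) (Fin n) ℂ →ₗ[ℂ] ℂ) : Matrix (Fin n) (Fin n) ℂ :=
  Matrix.of fun i j => ξ (Matrix.single j i 1)

theorem trace_densityMatrix_mul {n : ℕ} (ξ : Matrix (Fin n) (Fin n) ℂ →ₗ[ℂ] ℂ)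
    (A : Matrix (Fin n) (Fin n) ℂ) : (densityMatrix ξ * A).trace = ξ A := by
  conv_rhs => rw [Matrix.matrix_eq_sum_single A]
  simp only [map_sum, Matrix.trace, Matrix.diag, Matrix.mul_apply, densityMatrix, Matrix.of_apply]
  rw [Finset.sum_comm]
  refine Finset.sum_congr rfl fun i _ => Finset.sum_congr rfl fun j _ => ?_
  have : Matrix.single i j (A i j) = (A i j) • Matrix.single i j (1 : ℂ) := by
    simp [Matrix.smul_single]
  rw [this, map_smul, smul_eq_mul, mul_comm]

/-- `P` is the support of `ξ`: the smallest projection `Q` such that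
`ξ(A) = ξ(QA) = ξ(AQ) = ξ(QAQ)` for all `A`. -/
def IsSupport {n : ℕ} (ξ : Matrix (Fin n) (Fin n) ℂ →ₗ[ℂ] ℂ) (P : Matrix (Fin n) (Fin n) ℂ) :
    Prop :=
  IsLeast {Q | IsStarProjection Q ∧
    ∀ A, ξ (Q * A) = ξ A ∧ ξ (A * Q) = ξ A ∧ ξ (Q * A * Q) = ξ A} P

theorem exists_isSupport {n : ℕ} (ξ : Matrix (Fin n) (Fin n) ℂ →ₗ[ℂ] ℂ) : ∃ P, IsSupport ξ P := by
  set S := densityMatrix ξ with hS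
  have hξ : ∀ A, ξ A = (S * A).trace := fun A => (trace_densityMatrix_mul ξ A).symm
  set T := Sᴴ * S + S * Sᴴ with hT
  obtain ⟨h1, h2, h3, h4⟩ := pinv_spec T
  set P := pinv T * T with hP
  have hPP : P * P = P := by rw [hP, ← Matrix.mul_assoc, h2]
  have hPs : Pᴴ = P := h4
  have hTP : T * P = T := by rw [hP, ← Matrix.mul_assoc, h1]
  have hz : (S * (1 - P))ᴴ * (S * (1 - P)) + (Sᴴ * (1 - P))ᴴ * (Sᴴ * (1 - P)) = 0 := by
    have : (1 - P) * (T * (1 - P)) = 0 := by rw [Matrix.mul_sub T, hTP]; simp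
    rw [← this, hT]
    simp only [conjTranspose_mul, conjTranspose_sub, hPs, conjTranspose_one,
      conjTranspose_conjTranspose]
    noncomm_ring
  have hz' := (add_eq_zero_iff_of_nonneg
    (Matrix.nonneg_iff_posSemidef.2 (Matrix.posSemidef_conjTranspose_mul_self _))
    (Matrix.nonneg_iff_posSemidef.2 (Matrix.posSemidef_conjTranspose_mul_self _))).1 hz
  have hSP : S * P = S := by
    have := Matrix.conjTranspose_mul_self_eq_zero.1 hz'.1
    rw [Matrix.mul_sub, Matrix.mul_one] at this
    exact (sub_eq_zero.1 this).symm
  have hPS : P * S = S := by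
    have := Matrix.conjTranspose_mul_self_eq_zero.1 hz'.2
    rw [Matrix.mul_sub, Matrix.mul_one] at this
    have := congrArg conjTranspose (sub_eq_zero.1 this)
    simpa [conjTranspose_mul, hPs] using this.symm
  refine ⟨P, ⟨⟨hPP, hPs⟩, fun A => ⟨?_, ?_, ?_⟩⟩, ?_⟩
  · rw [hξ, hξ, ← Matrix.mul_assoc, hSP]
  · rw [hξ, hξ, ← Matrix.mul_assoc, Matrix.trace_mul_comm, ← Matrix.mul_assoc, hPS]
  · rw [hξ, hξ, ← Matrix.mul_assoc, Matrix.trace_mul_comm, ← Matrix.mul_assoc, ← Matrix.mul_assoc,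
      hPS, hSP]
  · rintro Q ⟨⟨hQQ, hQs⟩, hQ⟩
    have hQQ' : Q * Q = Q := hQQ
    have hQs' : Qᴴ = Q := hQs
    have hSQ : S * Q = S := by
      apply Matrix.ext_iff_trace_mul_right.2
      intro A
      rw [Matrix.mul_assoc, ← hξ, ← hξ]; exact (hQ A).1
    have hQS : Q * S = S := by
      apply Matrix.ext_iff_trace_mul_right.2
      intro A
      rw [Matrix.mul_assoc, Matrix.trace_mul_comm, Matrix.mul_assoc, ← hξ, ← hξ]; exact (hQ A).2.1
    have hSQ' : Sᴴ * Q = Sᴴ := by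
      have := congrArg conjTranspose hQS
      simpa [conjTranspose_mul, hQs'] using this
    have hTQ : T * Q = T := by
      rw [hT, Matrix.add_mul, Matrix.mul_assoc, Matrix.mul_assoc, hSQ, hSQ']
    have hPQ : P * Q = P := by rw [hP, Matrix.mul_assoc, hTQ]
    have hQP : Q * P = P := by
      have := congrArg conjTranspose hPQ
      simpa [conjTranspose_mul, hQs', hPs] using this
    rw [Matrix.le_iff]
    have : Q - P = (Q - P)ᴴ * (Q - P) := by
      rw [conjTranspose_sub, hQs', hPs, Matrix.mul_sub, Matrix.sub_mul, Matrix.sub_mul, hQQ', hPQ,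
        hQP, hPP]; simp
    rw [this]
    exact Matrix.posSemidef_conjTranspose_mul_self _

/-- The support `P_ξ` of `ξ`. -/
noncomputable def supportProj {n : ℕ} (ξ : Matrix (Fin n) (Fin n) ℂ →ₗ[ℂ] ℂ) :
    Matrix (Fin n) (Fin n) ℂ := Classical.choose (exists_isSupport ξ)

theorem supportProj_spec {n : ℕ} (ξ : Matrix (Fin n) (Fin n) ℂ →ₗ[ℂ] ℂ) : IsSupport ξ (supportProj ξ) :=
  Classical.choose_spec (exists_isSupport ξ)

/-- The Hilbert-Schmidt dual `F*`, characterized by `tr(F*(A) B) = tr(A F(B))`. -/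
def hsDual {m n : ℕ} (F : Matrix (Fin n) (Fin n) ℂ →ₗ[ℂ] Matrix (Fin m) (Fin m) ℂ) :
    Matrix (Fin m) (Fin m) ℂ →ₗ[ℂ] Matrix (Fin n) (Fin n) ℂ where
  toFun A := Matrix.of fun i j => (A * F (Matrix.single j i 1)).trace
  map_add' A B := by ext; simp [Matrix.add_mul]
  map_smul' c A := by ext; simp

theorem trace_hsDual_mul {m n : ℕ}
    (F : Matrix (Fin n) (Fin n) ℂ →ₗ[ℂ] Matrix (Fin m) (Fin m) ℂ)
    (A : Matrix (Fin m) (Fin m) ℂ) (B : Matrix (Fin n) (Fin n) ℂ) :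
    (hsDual F A * B).trace = (A * F B).trace :=
  trace_densityMatrix_mul (Matrix.traceLinearMap (Fin m) ℂ ℂ ∘ₗ LinearMap.mulLeft ℂ A ∘ₗ F) B

/-! ### Partial trace -/

/-- The partial trace `M_m ⊗ M_n → M_n` over the first factor. -/
def partialTrace {m n : ℕ} (M : Matrix (Fin m × Fin n) (Fin m × Fin n) ℂ) :
    Matrix (Fin n) (Fin n) ℂ :=
  Matrix.of fun k l => ∑ i, M (i, k) (i, l)

theorem partialTrace_kronecker {m n : ℕ} (A : Matrix (Fin m) (Fin m) ℂ)
    (B : Matrix (Fin n) (Fin n) ℂ) : partialTrace (A ⊗ₖ B) = A.trace • B := by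
  ext k l
  simp [partialTrace, Matrix.trace, Finset.sum_mul]

/-! ### Bayesian inverses -/

/-- `G` is a Bayesian inverse of `(F, ω)`: it is CPU and `ξ(G(A) B) = ω(A F(B))`, `ξ = ω ∘ F`. -/
structure IsBayesianInverse {m n : ℕ}
    (F : Matrix (Fin n) (Fin n) ℂ →ₗ[ℂ] Matrix (Fin m) (Fin m) ℂ)
    (ω : Matrix (Fin m) (Fin m) ℂ →ₗ[ℂ] ℂ)
    (G : Matrix (Fin m) (Fin m) ℂ →ₗ[ℂ] Matrix (Fin n) (Fin n) ℂ) : Prop where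
  isCPU : IsCPU G
  bayes : ∀ (A : Matrix (Fin m) (Fin m) ℂ) (B : Matrix (Fin n) (Fin n) ℂ),
    (ω ∘ₗ F) (G A * B) = ω (A * F B)

/-- `G` and `G'` are `ξ`-a.e. equivalent. -/
def AEEquivalent {m n : ℕ} (ξ : Matrix (Fin n) (Fin n) ℂ →ₗ[ℂ] ℂ)
    (G G' : Matrix (Fin m) (Fin m) ℂ →ₗ[ℂ] Matrix (Fin n) (Fin n) ℂ) : Prop :=
  ∀ (B : Matrix (Fin n) (Fin n) ℂ) (A : Matrix (Fin m) (Fin m) ℂ), ξ (B * G A) = ξ (B * G' A)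

end MatrixBayes

open MatrixBayes

namespace MatrixBayes

open Matrix

/-! ### Positive semidefinite matrices and pseudoinverses -/

section Abstract

variable {ι : Type*} [Fintype ι]

/-! Everything is read off Choi matrices, where the problem becomes a positive completion problem.
Put `Q = 1 ⊗ P` with `P` the support, `K = ρᵀ ⊗ σ̂`, `M` the Choi matrix of `F*`, and `T = K * M`. A
map `G` with Choi matrix `C` is a Bayesian inverse iff `C ≥ 0`, its partial trace is `1`, and `Q * C
= T` (`isBayesianInverse_iff_choi`). So the top block row of `C` relative to `Q` is prescribed, with
blocks 𝔄 = `T * Q` and 𝔅 = `T * (1 - Q)`, and only the bottom corner is free.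

If `C` exists, 𝔄 = `Q * C * Q` is Hermitian, and the partial trace of the positive Schur complement
gives the inequality. Conversely, hermiticity of 𝔄 already forces 𝔄 ≥ 0 and 𝔄𝔄̂𝔅 = 𝔅, because `K`
and `M` are positive (`posSemidef_mul_mul_proj`, `mul_pinv_mul_offDiag`). Then `Tᴴ * 𝔄̂ * T` is a
positive completion; the inequality says that what its partial trace lacks from `1` is positive and
can be added in the free corner (`exists_completion`). Equality leaves no room in that corner,
whence uniqueness. Without it, `Q * C = T` still determines `C * Q`, which is all that `ξ` sees. -/

open scoped Matrix.Norms.L2Operator in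
theorem posSemidef_iff_exists_conjTranspose_mul_self {A : Matrix ι ι ℂ} :
    A.PosSemidef ↔ ∃ B : Matrix ι ι ℂ, A = Bᴴ * B := by
  classical
  rw [← Matrix.nonneg_iff_posSemidef]
  exact cstar_nonneg_iff A

open scoped Matrix.Norms.L2Operator in
theorem posSemidef_mul_of_commute {A B : Matrix ι ι ℂ} (hA : A.PosSemidef) (hB : B.PosSemidef)
    (h : A * B = B * A) : (A * B).PosSemidef := by
  classical
  rw [← Matrix.nonneg_iff_posSemidef] at *
  exact Commute.mul_nonneg hA hB h

/-- The kernel of a positive semidefinite form consists of its isotropic vectors. -/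
theorem mul_eq_zero_of_conjTranspose_mul_mul_eq_zero {A : Matrix ι ι ℂ} (hA : A.PosSemidef)
    {X : Matrix ι ι ℂ} (h : Xᴴ * A * X = 0) : A * X = 0 := by
  obtain ⟨B, rfl⟩ := posSemidef_iff_exists_conjTranspose_mul_self.1 hA
  have : (B * X)ᴴ * (B * X) = 0 := by
    rw [← h]; simp only [conjTranspose_mul, Matrix.mul_assoc]
  rw [Matrix.mul_assoc, Matrix.conjTranspose_mul_self_eq_zero.1 this, Matrix.mul_zero]

/-- For Hermitian `A` the Penrose equations are stable under taking adjoints, so uniqueness applies.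
-/
theorem conjTranspose_pinv {A : Matrix ι ι ℂ} (hA : Aᴴ = A) : (pinv A)ᴴ = pinv A := by
  obtain ⟨h1, h2, h3, h4⟩ := pinv_spec A
  refine IsMoorePenroseInverse.unique (A := A) ⟨?_, ?_, ?_, ?_⟩ (pinv_spec A)
  · have := congrArg conjTranspose h1
    simpa [conjTranspose_mul, hA, Matrix.mul_assoc] using this
  · have := congrArg conjTranspose h2
    simpa [conjTranspose_mul, hA, Matrix.mul_assoc] using this
  · have : A * (pinv A)ᴴ = pinv A * A := by rw [← h4.eq, conjTranspose_mul, hA]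
    rw [this]; exact h4
  · have : (pinv A)ᴴ * A = A * pinv A := by rw [← h3.eq, conjTranspose_mul, hA]
    rw [this]; exact h3

theorem pinv_mul_comm {A : Matrix ι ι ℂ} (hA : Aᴴ = A) : pinv A * A = A * pinv A := by
  rw [← (pinv_spec A).left_isHermitian.eq, conjTranspose_mul, hA, conjTranspose_pinv hA]

theorem posSemidef_pinv {A : Matrix ι ι ℂ} (hA : A.PosSemidef) : (pinv A).PosSemidef := by
  have := hA.conjTranspose_mul_mul_same (pinv A)
  rwa [conjTranspose_pinv hA.isHermitian.eq, (pinv_spec A).self_mul_mul] at this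

/-- A Hermitian product `K M Q` of positive semidefinite `K ∈ Q M_ι Q` and `M` is positive
semidefinite: `K` commutes with `Q M Q`. -/
theorem posSemidef_mul_mul_proj {K M Q : Matrix ι ι ℂ} (hK : K.PosSemidef) (hM : M.PosSemidef)
    (hQ : IsStarProjection Q) (hKQ : K * Q = K) (hA : (K * M * Q)ᴴ = K * M * Q) :
    (K * M * Q).PosSemidef := by
  have hQs : Qᴴ = Q := hQ.isSelfAdjoint
  have hM' : (Q * M * Q).PosSemidef := by
    have := hM.conjTranspose_mul_mul_same Q
    rwa [hQs] at this
  have e : K * M * Q = K * (Q * M * Q) := by simp only [← Matrix.mul_assoc, hKQ]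
  rw [e] at hA ⊢
  refine posSemidef_mul_of_commute hK hM' ?_
  rw [← hA, conjTranspose_mul, hK.isHermitian.eq, hM'.isHermitian.eq]

variable [DecidableEq ι]

theorem conjTranspose_one_sub_of_isStarProjection {Q : Matrix ι ι ℂ} (hQ : IsStarProjection Q) :
    (1 - Q)ᴴ = 1 - Q := hQ.one_sub.isSelfAdjoint

/-- The range condition for the off-diagonal block. -/
theorem mul_pinv_mul_offDiag {K M Q : Matrix ι ι ℂ} (hK : K.PosSemidef) (hM : M.PosSemidef)
    (hQ : IsStarProjection Q) (hKQ : K * Q = K) (hA : (K * M * Q)ᴴ = K * M * Q) :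
    K * M * Q * pinv (K * M * Q) * (K * M * (1 - Q)) = K * M * (1 - Q) := by
  have hQs : Qᴴ = Q := hQ.isSelfAdjoint
  set A := K * M * Q with hAdef
  have hKs := hK.isHermitian.eq
  have hMs := hM.isHermitian.eq
  have hQK : Q * K = K := by
    have := congrArg conjTranspose hKQ
    rwa [conjTranspose_mul, hQs, hKs] at this
  -- `Z` projects onto the kernel of the Hermitian matrix `A`. Since `A = Q * M * K` too, the
  -- columns of `K * Z` are isotropic for `M`, hence killed by `M`; the adjoint says `Z * K * M =
  -- 0`.
  set Z := 1 - A * pinv A with hZ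
  have hZs : Zᴴ = Z := by
    rw [hZ, conjTranspose_sub, conjTranspose_one, (pinv_spec A).left_isHermitian.eq]
  have hAZ : A * Z = 0 := by
    rw [hZ, ← pinv_mul_comm hA, Matrix.mul_sub, ← Matrix.mul_assoc, (pinv_spec A).mul_mul_self,
      Matrix.mul_one, sub_self]
  have hA' : Q * M * K = A := by
    rw [← hA, hAdef]; simp only [conjTranspose_mul, hKs, hMs, hQs, Matrix.mul_assoc]
  have hX : (K * Z)ᴴ * M * (K * Z) = 0 := by
    calc (K * Z)ᴴ * M * (K * Z) = Zᴴ * (K * Q) * M * (K * Z) := by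
          rw [conjTranspose_mul, hKs, hKQ]
      _ = Zᴴ * K * ((Q * M * K) * Z) := by simp only [Matrix.mul_assoc]
      _ = 0 := by rw [hA', hAZ, Matrix.mul_zero]
  have h0 := mul_eq_zero_of_conjTranspose_mul_mul_eq_zero hM hX
  have h1 : Z * K * M = 0 := by
    have := congrArg conjTranspose h0
    simpa [conjTranspose_mul, hKs, hMs, hZs, Matrix.mul_assoc] using this
  have h2 : Z * (K * M * (1 - Q)) = 0 := by
    rw [← Matrix.mul_assoc, ← Matrix.mul_assoc, h1, Matrix.zero_mul]
  rw [hZ, Matrix.sub_mul, Matrix.one_mul, sub_eq_zero] at h2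
  exact h2.symm

/-- The Schur complement of a corner of a positive semidefinite matrix. -/
theorem posSemidef_schur_compl {C Q : Matrix ι ι ℂ} (hC : C.PosSemidef) (hQ : IsStarProjection Q) :
    ((1 - Q) * C * (1 - Q) -
      (Q * C * (1 - Q))ᴴ * pinv (Q * C * Q) * (Q * C * (1 - Q))).PosSemidef := by
  have hQs : Qᴴ = Q := hQ.isSelfAdjoint
  have hQ's := conjTranspose_one_sub_of_isStarProjection hQ
  have hQQ : Q * Q = Q := hQ.isIdempotentElem
  have hCs := hC.isHermitian.eq
  set A := Q * C * Q with hA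
  have hAs : Aᴴ = A := by simp [hA, conjTranspose_mul, hQs, hCs, Matrix.mul_assoc]
  have h2 := (pinv_spec A).self_mul_mul
  have hQA : Q * A = A := by simp only [hA, ← Matrix.mul_assoc, hQQ]
  have hQp : Q * pinv A = pinv A := by
    rw [← h2, pinv_mul_comm hAs, ← Matrix.mul_assoc, ← Matrix.mul_assoc, hQA]
  have hps := conjTranspose_pinv hAs
  have hpQ : pinv A * Q = pinv A := by
    have := congrArg conjTranspose hQp
    rwa [conjTranspose_mul, hQs, hps] at this
  have hB : (Q * C * (1 - Q))ᴴ = (1 - Q) * C * Q := by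
    simp only [conjTranspose_mul, hQs, hQ's, hCs, Matrix.mul_assoc]
  -- Congruence by the second block column of the elimination matrix; `pinv A * C * pinv A = pinv A`
  -- collapses it to the Schur complement.
  have key := hC.conjTranspose_mul_mul_same ((1 - Q) - pinv A * (Q * C * (1 - Q)))
  convert key using 1
  have e1 : pinv A * (Q * C * (1 - Q)) = pinv A * C * (1 - Q) := by
    simp only [← Matrix.mul_assoc, hpQ]
  have e2 : (pinv A * C * (1 - Q))ᴴ = (1 - Q) * C * pinv A := by
    simp only [conjTranspose_mul, hps, hQ's, hCs, Matrix.mul_assoc]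
  have e3 : pinv A * C * pinv A = pinv A := by
    calc pinv A * C * pinv A = (pinv A * Q) * C * (Q * pinv A) := by rw [hpQ, hQp]
      _ = pinv A * A * pinv A := by simp only [hA, Matrix.mul_assoc]
      _ = pinv A := h2
  have e4 : (1 - Q) * C * Q * pinv A * (Q * C * (1 - Q)) = (1 - Q) * C * pinv A * C * (1 - Q) := by
    rw [Matrix.mul_assoc _ Q, hQp]
    simp only [← Matrix.mul_assoc]
    rw [Matrix.mul_assoc _ (pinv A) Q, hpQ]
  rw [hB, e4, e1, conjTranspose_sub, hQ's, e2]
  have e5 : (1 - Q) * C * pinv A * C * (pinv A * C * (1 - Q)) =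
      (1 - Q) * C * pinv A * C * (1 - Q) := by
    calc _ = (1 - Q) * C * (pinv A * C * pinv A) * C * (1 - Q) := by simp only [Matrix.mul_assoc]
      _ = _ := by rw [e3]
  generalize 1 - Q = R at *
  rw [Matrix.sub_mul, Matrix.sub_mul, Matrix.mul_sub, Matrix.mul_sub, e5]
  simp only [Matrix.mul_assoc]
  abel

end Abstract

/-! ### Choi matrices -/

section Choi

variable {m n : ℕ}

/-- The Choi matrix `∑ E_ij ⊗ φ(E_ij)`. -/
def choi (φ : Matrix (Fin m) (Fin m) ℂ →ₗ[ℂ] Matrix (Fin n) (Fin n) ℂ) :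
    Matrix (Fin m × Fin n) (Fin m × Fin n) ℂ :=
  Matrix.of fun x y => φ (Matrix.single x.1 y.1 1) x.2 y.2

theorem sum_single_kronecker_eq_choi
    (φ : Matrix (Fin m) (Fin m) ℂ →ₗ[ℂ] Matrix (Fin n) (Fin n) ℂ) :
    ∑ i : Fin m, ∑ j : Fin m, Matrix.single i j (1 : ℂ) ⊗ₖ φ (Matrix.single i j 1) = choi φ := by
  ext ⟨i, k⟩ ⟨j, l⟩
  simp only [Matrix.sum_apply, Matrix.kronecker_apply, choi, Matrix.of_apply]
  rw [Finset.sum_eq_single i, Finset.sum_eq_single j] <;> simp +contextual [Matrix.single]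

/-- The linear map with a given Choi matrix. -/
def ofChoi (C : Matrix (Fin m × Fin n) (Fin m × Fin n) ℂ) :
    Matrix (Fin m) (Fin m) ℂ →ₗ[ℂ] Matrix (Fin n) (Fin n) ℂ where
  toFun A := Matrix.of fun k l => ∑ i, ∑ j, A i j * C (i, k) (j, l)
  map_add' A B := by ext; simp [add_mul, Finset.sum_add_distrib]
  map_smul' c A := by ext; simp [Finset.mul_sum, mul_assoc]

theorem ofChoi_apply (C : Matrix (Fin m × Fin n) (Fin m × Fin n) ℂ) (A : Matrix (Fin m) (Fin m) ℂ)
    (k l : Fin n) : ofChoi C A k l = ∑ i, ∑ j, A i j * C (i, k) (j, l) := rfl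

theorem choi_ofChoi (C : Matrix (Fin m × Fin n) (Fin m × Fin n) ℂ) : choi (ofChoi C) = C := by
  ext ⟨i, k⟩ ⟨j, l⟩
  simp only [choi, Matrix.of_apply, ofChoi_apply]
  rw [Finset.sum_eq_single i, Finset.sum_eq_single j] <;> simp +contextual [Matrix.single, eq_comm]

theorem ofChoi_choi (φ : Matrix (Fin m) (Fin m) ℂ →ₗ[ℂ] Matrix (Fin n) (Fin n) ℂ) :
    ofChoi (choi φ) = φ := by
  refine LinearMap.ext fun A => ?_
  ext k l
  rw [ofChoi_apply]
  conv_rhs => rw [Matrix.matrix_eq_sum_single A]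
  simp only [map_sum, Matrix.sum_apply, choi, Matrix.of_apply]
  refine Finset.sum_congr rfl fun i _ => Finset.sum_congr rfl fun j _ => ?_
  have : Matrix.single i j (A i j) = (A i j) • Matrix.single i j (1 : ℂ) := by
    simp [Matrix.smul_single]
  rw [this, map_smul, Matrix.smul_apply, smul_eq_mul]

theorem choi_injective {φ ψ : Matrix (Fin m) (Fin m) ℂ →ₗ[ℂ] Matrix (Fin n) (Fin n) ℂ}
    (h : choi φ = choi ψ) : φ = ψ := by
  rw [← ofChoi_choi φ, h, ofChoi_choi]

theorem choi_mulLeft_comp (X : Matrix (Fin n) (Fin n) ℂ)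
    (φ : Matrix (Fin m) (Fin m) ℂ →ₗ[ℂ] Matrix (Fin n) (Fin n) ℂ) :
    choi (LinearMap.mulLeft ℂ X ∘ₗ φ) = ((1 : Matrix (Fin m) (Fin m) ℂ) ⊗ₖ X) * choi φ := by
  ext ⟨i, k⟩ ⟨j, l⟩
  simp [choi, Matrix.mul_apply, Fintype.sum_prod_type, Matrix.one_apply]

theorem choi_mulRight_comp (X : Matrix (Fin n) (Fin n) ℂ)
    (φ : Matrix (Fin m) (Fin m) ℂ →ₗ[ℂ] Matrix (Fin n) (Fin n) ℂ) :
    choi (LinearMap.mulRight ℂ X ∘ₗ φ) = choi φ * ((1 : Matrix (Fin m) (Fin m) ℂ) ⊗ₖ X) := by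
  ext ⟨i, k⟩ ⟨j, l⟩
  simp [choi, Matrix.mul_apply, Fintype.sum_prod_type, Matrix.one_apply]

/-- The transpose arises because `ρ E_ij = ∑ₐ ρ_ai E_aj`: the row index of `ρ` is the one summed
over. -/
theorem choi_comp_mulLeft (ρ : Matrix (Fin m) (Fin m) ℂ)
    (φ : Matrix (Fin m) (Fin m) ℂ →ₗ[ℂ] Matrix (Fin n) (Fin n) ℂ) :
    choi (φ ∘ₗ LinearMap.mulLeft ℂ ρ) = (ρᵀ ⊗ₖ (1 : Matrix (Fin n) (Fin n) ℂ)) * choi φ := by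
  ext ⟨i, k⟩ ⟨j, l⟩
  have h : φ (ρ * Matrix.single i j 1) k l = ofChoi (choi φ) (ρ * Matrix.single i j 1) k l := by
    rw [ofChoi_choi]
  simp only [choi, Matrix.of_apply, LinearMap.comp_apply, LinearMap.mulLeft_apply] at h ⊢
  rw [h, ofChoi_apply]
  simp [Matrix.mul_apply, Fintype.sum_prod_type, Matrix.one_apply, Matrix.single, ite_and]

/-! ### Partial traces -/

/-- Turns unitality into a linear condition on the Choi matrix. -/
theorem partialTrace_choi (φ : Matrix (Fin m) (Fin m) ℂ →ₗ[ℂ] Matrix (Fin n) (Fin n) ℂ) :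
    partialTrace (choi φ) = φ 1 := by
  ext k l
  rw [← Matrix.sum_single_one]
  simp [partialTrace, choi, Matrix.sum_apply]

theorem partialTrace_add (X Y : Matrix (Fin m × Fin n) (Fin m × Fin n) ℂ) :
    partialTrace (X + Y) = partialTrace X + partialTrace Y := by
  ext; simp [partialTrace, Finset.sum_add_distrib]

theorem partialTrace_sub (X Y : Matrix (Fin m × Fin n) (Fin m × Fin n) ℂ) :
    partialTrace (X - Y) = partialTrace X - partialTrace Y := by
  ext; simp [partialTrace, Finset.sum_sub_distrib]

theorem partialTrace_one_kronecker_mul (X : Matrix (Fin n) (Fin n) ℂ)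
    (C : Matrix (Fin m × Fin n) (Fin m × Fin n) ℂ) :
    partialTrace (((1 : Matrix (Fin m) (Fin m) ℂ) ⊗ₖ X) * C) = X * partialTrace C := by
  rw [← choi_ofChoi C, ← choi_mulLeft_comp, partialTrace_choi, partialTrace_choi]; rfl

theorem partialTrace_mul_one_kronecker (X : Matrix (Fin n) (Fin n) ℂ)
    (C : Matrix (Fin m × Fin n) (Fin m × Fin n) ℂ) :
    partialTrace (C * ((1 : Matrix (Fin m) (Fin m) ℂ) ⊗ₖ X)) = partialTrace C * X := by
  rw [← choi_ofChoi C, ← choi_mulRight_comp, partialTrace_choi, partialTrace_choi]; rfl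

theorem trace_partialTrace (X : Matrix (Fin m × Fin n) (Fin m × Fin n) ℂ) :
    (partialTrace X).trace = X.trace := by
  simp only [partialTrace, Matrix.trace, Matrix.diag, Matrix.of_apply, Fintype.sum_prod_type]
  exact Finset.sum_comm

theorem posSemidef_partialTrace {X : Matrix (Fin m × Fin n) (Fin m × Fin n) ℂ}
    (hX : X.PosSemidef) : (partialTrace X).PosSemidef := by
  have : partialTrace X = ∑ i, X.submatrix (fun k => (i, k)) (fun k => (i, k)) := by
    ext; simp [partialTrace, Matrix.sum_apply]
  rw [this]
  exact posSemidef_sum _ fun i _ => hX.submatrix _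

/-! ### Choi's theorem -/

/-- The Choi matrix is the image of the positive rank-one matrix `∑ E_ij ⊗ E_ij`. Conversely,
contracting Gram factors of `M` and of the Choi matrix over the shared index gives a Gram factor of
`(id ⊗ φ)(M)`. -/
theorem isCompletelyPositive_iff_choi
    (φ : Matrix (Fin m) (Fin m) ℂ →ₗ[ℂ] Matrix (Fin n) (Fin n) ℂ) :
    IsCompletelyPositive φ ↔ (choi φ).PosSemidef := by
  rw [isCompletelyPositive_iff]
  constructor
  · intro h
    refine h m (Matrix.of fun i j => Matrix.single i j 1) ?_
    -- The unnormalised maximally entangled vector `∑ eᵢ ⊗ eᵢ`.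
    have := posSemidef_vecMulVec_self_star (fun x : Fin m × Fin m => if x.1 = x.2 then (1 : ℂ) else 0)
    convert this using 1
    ext ⟨i, a⟩ ⟨j, b⟩
    simp only [Matrix.comp_apply, Matrix.of_apply, Matrix.vecMulVec_apply, Matrix.single_apply,
      Pi.star_apply, RCLike.star_def, apply_ite (starRingEnd ℂ), map_one, map_zero]
    grind
  · intro hC k M hM
    obtain ⟨L, hL⟩ := posSemidef_iff_exists_conjTranspose_mul_self.1 hC
    obtain ⟨N, hN⟩ := posSemidef_iff_exists_conjTranspose_mul_self.1 hM
    have key : Matrix.comp _ _ _ _ _ (M.map φ) =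
        (Matrix.of fun (p : (Fin k × Fin m) × (Fin m × Fin n)) (x : Fin k × Fin n) =>
          ∑ i, N p.1 (x.1, i) * L p.2 (i, x.2))ᴴ *
        (Matrix.of fun (p : (Fin k × Fin m) × (Fin m × Fin n)) (x : Fin k × Fin n) =>
          ∑ i, N p.1 (x.1, i) * L p.2 (i, x.2)) := by
      ext ⟨a, s⟩ ⟨b, t⟩
      have e1 : ∀ i j, M a b i j = ∑ p, star (N p (a, i)) * N p (b, j) := fun i j => by
        have := congrFun (congrFun hN (a, i)) (b, j)
        simpa [Matrix.mul_apply] using this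
      have e2 : ∀ i j, choi φ (i, s) (j, t) = ∑ q, star (L q (i, s)) * L q (j, t) := fun i j => by
        have := congrFun (congrFun hL (i, s)) (j, t)
        simpa [Matrix.mul_apply] using this
      change φ (M a b) s t = _
      conv_lhs => rw [← ofChoi_choi φ]
      rw [ofChoi_apply]
      rw [Matrix.mul_apply, Fintype.sum_prod_type]
      simp only [e1, e2, Matrix.conjTranspose_apply, Matrix.of_apply, star_sum,
        Finset.sum_mul_sum, star_mul']
      rw [Finset.sum_congr rfl fun i _ => Finset.sum_comm, Finset.sum_comm]
      refine Finset.sum_congr rfl fun p _ => ?_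
      rw [Finset.sum_congr rfl fun i _ => Finset.sum_comm, Finset.sum_comm]
      refine Finset.sum_congr rfl fun q _ => Finset.sum_congr rfl fun i _ =>
        Finset.sum_congr rfl fun j _ => ?_
      ring
    rw [key]
    exact posSemidef_conjTranspose_mul_self _

/-- Dualising transposes the Choi matrix and swaps its tensor factors; both operations preserve
positivity. -/
theorem posSemidef_choi_hsDual {F : Matrix (Fin n) (Fin n) ℂ →ₗ[ℂ] Matrix (Fin m) (Fin m) ℂ}
    (hF : IsCompletelyPositive F) : (choi (hsDual F)).PosSemidef := by
  have h := ((isCompletelyPositive_iff_choi F).1 hF).transpose.submatrix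
    (Prod.swap : Fin m × Fin n → Fin n × Fin m)
  have e : choi (hsDual F) = (choi F)ᵀ.submatrix Prod.swap Prod.swap := by
    ext ⟨i, k⟩ ⟨j, l⟩
    simp [choi, hsDual, Matrix.trace_single_mul]
  rw [e]
  exact h

end Choi

/-! ### The support projection -/

section Support

variable {n : ℕ} (ξ : Matrix (Fin n) (Fin n) ℂ →ₗ[ℂ] ℂ)

theorem isStarProjection_supportProj : IsStarProjection (supportProj ξ) :=
  (supportProj_spec ξ).1.1

theorem densityMatrix_mul_supportProj : densityMatrix ξ * supportProj ξ = densityMatrix ξ := by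
  apply Matrix.ext_iff_trace_mul_right.2
  intro A
  rw [Matrix.mul_assoc, trace_densityMatrix_mul, trace_densityMatrix_mul]
  exact ((supportProj_spec ξ).1.2 A).1

variable {ξ}

/-- The range projection of `σ` satisfies the support equations, so minimality bounds the support
above by it; `σ * P = σ` gives the reverse bound. -/
theorem pinv_densityMatrix_mul (h : (densityMatrix ξ)ᴴ = densityMatrix ξ) :
    pinv (densityMatrix ξ) * densityMatrix ξ = supportProj ξ := by
  set σ := densityMatrix ξ with hσ
  obtain ⟨h1, h2, h3, h4⟩ := pinv_spec σ
  have hP0 : IsStarProjection (pinv σ * σ) :=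
    ⟨by rw [IsIdempotentElem, ← Matrix.mul_assoc, h2], h4⟩
  have hσP0 : σ * (pinv σ * σ) = σ := by rw [← Matrix.mul_assoc, h1]
  have hP0σ : (pinv σ * σ) * σ = σ := by rw [pinv_mul_comm h, h1]
  have hξ : ∀ A, ξ A = (σ * A).trace := fun A => (trace_densityMatrix_mul ξ A).symm
  have hle : supportProj ξ ≤ pinv σ * σ := by
    refine (supportProj_spec ξ).2 ⟨hP0, fun A => ⟨?_, ?_, ?_⟩⟩
    · rw [hξ, hξ, ← Matrix.mul_assoc, hσP0]
    · rw [hξ, hξ, ← Matrix.mul_assoc, Matrix.trace_mul_comm, ← Matrix.mul_assoc, hP0σ]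
    · rw [hξ, hξ, ← Matrix.mul_assoc, Matrix.trace_mul_comm, ← Matrix.mul_assoc,
        ← Matrix.mul_assoc, hP0σ, hσP0]
  have hge : pinv σ * σ * supportProj ξ = pinv σ * σ := by
    rw [Matrix.mul_assoc, densityMatrix_mul_supportProj]
  set P := supportProj ξ with hPdef
  have hPP := isStarProjection_supportProj ξ
  have hPs : Pᴴ = P := hPP.isSelfAdjoint
  have hge' : P * (pinv σ * σ) = pinv σ * σ := by
    have := congrArg conjTranspose hge
    rwa [conjTranspose_mul, h4.eq, hPs] at this
  refine le_antisymm ?_ hle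
  have e : P - pinv σ * σ = (P - pinv σ * σ)ᴴ * (P - pinv σ * σ) := by
    rw [conjTranspose_sub, hPs, h4.eq, Matrix.mul_sub, Matrix.sub_mul, Matrix.sub_mul, hge, hge',
      hP0.isIdempotentElem.eq, hPP.isIdempotentElem.eq, sub_self, sub_zero]
  rw [Matrix.le_iff, e]
  exact posSemidef_conjTranspose_mul_self _

theorem densityMatrix_mul_pinv (h : (densityMatrix ξ)ᴴ = densityMatrix ξ) :
    densityMatrix ξ * pinv (densityMatrix ξ) = supportProj ξ := by
  rw [← pinv_mul_comm h, pinv_densityMatrix_mul h]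

theorem pinv_densityMatrix_mul_supportProj (h : (densityMatrix ξ)ᴴ = densityMatrix ξ) :
    pinv (densityMatrix ξ) * supportProj ξ = pinv (densityMatrix ξ) := by
  rw [← densityMatrix_mul_pinv h, ← Matrix.mul_assoc, (pinv_spec _).self_mul_mul]

end Support

/-! ### The Bayes condition for Choi matrices -/

section Bayes

variable {m n : ℕ}

theorem partialTrace_conjTranspose (X : Matrix (Fin m × Fin n) (Fin m × Fin n) ℂ) :
    partialTrace Xᴴ = (partialTrace X)ᴴ := by
  ext; simp [partialTrace]

theorem partialTrace_smul (c : ℂ) (X : Matrix (Fin m × Fin n) (Fin m × Fin n) ℂ) :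
    partialTrace (c • X) = c • partialTrace X := by
  ext; simp [partialTrace, Finset.mul_sum]

theorem one_kronecker_mul (X Y : Matrix (Fin n) (Fin n) ℂ) :
    ((1 : Matrix (Fin m) (Fin m) ℂ) ⊗ₖ X) * (1 ⊗ₖ Y) = 1 ⊗ₖ (X * Y) := by
  rw [← Matrix.mul_kronecker_mul, Matrix.one_mul]

theorem kronecker_one_sub (A : Matrix (Fin m) (Fin m) ℂ) (X : Matrix (Fin n) (Fin n) ℂ) :
    A ⊗ₖ (1 - X) = A ⊗ₖ 1 - A ⊗ₖ X := by
  ext; simp [mul_sub]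

theorem one_kronecker_one_sub (X : Matrix (Fin n) (Fin n) ℂ) :
    (1 : Matrix (Fin m) (Fin m) ℂ) ⊗ₖ (1 - X) = 1 - 1 ⊗ₖ X := by
  rw [kronecker_one_sub, Matrix.one_kronecker_one]

theorem isStarProjection_one_kronecker {P : Matrix (Fin n) (Fin n) ℂ} (hP : IsStarProjection P) :
    IsStarProjection ((1 : Matrix (Fin m) (Fin m) ℂ) ⊗ₖ P) := by
  have hPs : Pᴴ = P := hP.isSelfAdjoint
  refine ⟨?_, ?_⟩
  · rw [IsIdempotentElem, one_kronecker_mul, hP.isIdempotentElem.eq]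
  · change (_ ⊗ₖ _)ᴴ = _
    rw [Matrix.conjTranspose_kronecker, conjTranspose_one, hPs]

variable {F : Matrix (Fin n) (Fin n) ℂ →ₗ[ℂ] Matrix (Fin m) (Fin m) ℂ}
  {ρ : Matrix (Fin m) (Fin m) ℂ}

theorem partialTrace_kronecker_mul_choi_hsDual :
    partialTrace ((ρᵀ ⊗ₖ (1 : Matrix (Fin n) (Fin n) ℂ)) * choi (hsDual F)) = hsDual F ρ := by
  rw [← choi_comp_mulLeft, partialTrace_choi]
  simp

theorem posSemidef_hsDual (hF : IsCompletelyPositive F) (hρ : ρ.PosSemidef) :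
    (hsDual F ρ).PosSemidef := by
  have h := (isCompletelyPositive_iff _).1
    ((isCompletelyPositive_iff_choi _).2 (posSemidef_choi_hsDual hF)) 1 (Matrix.of fun _ _ => ρ)
    (hρ.submatrix Prod.snd)
  exact h.submatrix (fun k => ((0 : Fin 1), k))

/-- `F*(ρ A)` has range in the support of `F*(ρ)`. -/
theorem kronecker_mul_choi_hsDual_eq_zero (hF : IsCompletelyPositive F) (hρ : ρ.PosSemidef)
    {R : Matrix (Fin n) (Fin n) ℂ} (hR : IsStarProjection R) (h : R * hsDual F ρ = 0) :
    (ρᵀ ⊗ₖ R) * choi (hsDual F) = 0 := by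
  have hM := posSemidef_choi_hsDual hF
  have hRs : Rᴴ = R := hR.isSelfAdjoint
  set M := choi (hsDual F) with hMdef
  obtain ⟨L, hL⟩ := posSemidef_iff_exists_conjTranspose_mul_self.1 hρ.transpose
  have e : (Lᴴ ⊗ₖ R) * (L ⊗ₖ R) = ρᵀ ⊗ₖ R := by
    rw [← Matrix.mul_kronecker_mul, ← hL, hR.isIdempotentElem.eq]
  have hps := hM.mul_mul_conjTranspose_same (L ⊗ₖ R)
  have hs : (L ⊗ₖ R)ᴴ = Lᴴ ⊗ₖ R := by rw [Matrix.conjTranspose_kronecker, hRs]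
  -- By cyclicity and the partial trace this is `tr(R F*(ρ))`. A positive matrix of trace zero
  -- vanishes, so `M` kills `(L ⊗ R)ᴴ`.
  have h0 : ((L ⊗ₖ R) * M * (L ⊗ₖ R)ᴴ).trace = 0 := by
    have e2 : (ρᵀ ⊗ₖ R) = ((1 : Matrix (Fin m) (Fin m) ℂ) ⊗ₖ R) * (ρᵀ ⊗ₖ 1) := by
      rw [← Matrix.mul_kronecker_mul, Matrix.one_mul, Matrix.mul_one]
    rw [Matrix.trace_mul_comm, ← Matrix.mul_assoc, hs, e, e2, Matrix.mul_assoc,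
      ← trace_partialTrace, partialTrace_one_kronecker_mul, partialTrace_kronecker_mul_choi_hsDual, h,
      Matrix.trace_zero]
  rw [hps.trace_eq_zero_iff] at h0
  have h1 : M * (L ⊗ₖ R)ᴴ = 0 := by
    refine mul_eq_zero_of_conjTranspose_mul_mul_eq_zero hM ?_
    rwa [conjTranspose_conjTranspose]
  have h2 : (L ⊗ₖ R) * M = 0 := by
    have := congrArg conjTranspose h1
    rwa [conjTranspose_mul, conjTranspose_conjTranspose, hM.isHermitian.eq,
      conjTranspose_zero] at this
  rw [← e, Matrix.mul_assoc, h2, Matrix.mul_zero]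

/-- By nondegeneracy of the trace pairing, the Bayes condition reads `σ G(A) = F*(ρA)`; multiplying
by `σ̂` puts it in the form `P G(A) = σ̂ F*(ρA)`. -/
theorem isBayesianInverse_iff_choi (hF : IsCompletelyPositive F) (hρ : ρ.PosSemidef)
    (G : Matrix (Fin m) (Fin m) ℂ →ₗ[ℂ] Matrix (Fin n) (Fin n) ℂ) :
    IsBayesianInverse F (traceFunctional ρ) G ↔
      (choi G).PosSemidef ∧ partialTrace (choi G) = 1 ∧
        ((1 : Matrix (Fin m) (Fin m) ℂ) ⊗ₖ supportProj (traceFunctional ρ ∘ₗ F)) * choi G =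
          (ρᵀ ⊗ₖ pinv (densityMatrix (traceFunctional ρ ∘ₗ F))) * choi (hsDual F) := by
  set ξ := traceFunctional ρ ∘ₗ F with hξ
  have hσ : densityMatrix ξ = hsDual F ρ := rfl
  have hσs : (densityMatrix ξ)ᴴ = densityMatrix ξ := by
    rw [hσ]; exact (posSemidef_hsDual hF hρ).isHermitian.eq
  have hbayes : (∀ A B, ξ (G A * B) = traceFunctional ρ (A * F B)) ↔
      ((1 : Matrix (Fin m) (Fin m) ℂ) ⊗ₖ densityMatrix ξ) * choi G =
        (ρᵀ ⊗ₖ (1 : Matrix (Fin n) (Fin n) ℂ)) * choi (hsDual F) := by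
    rw [← choi_mulLeft_comp, ← choi_comp_mulLeft]
    have hB : ∀ A B, traceFunctional ρ (A * F B) = (hsDual F (ρ * A) * B).trace := fun A B => by
      rw [trace_hsDual_mul, Matrix.mul_assoc]; rfl
    constructor
    · intro h
      congr 1
      refine LinearMap.ext fun A => Matrix.ext_iff_trace_mul_right.2 fun B => ?_
      change (densityMatrix ξ * G A * B).trace = (hsDual F (ρ * A) * B).trace
      rw [Matrix.mul_assoc, trace_densityMatrix_mul, h, hB]
    · intro h A B
      have := LinearMap.congr_fun (choi_injective h) A
      change densityMatrix ξ * G A = hsDual F (ρ * A) at this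
      rw [← trace_densityMatrix_mul, hB, ← this, Matrix.mul_assoc]
  have hsupp : ((1 : Matrix (Fin m) (Fin m) ℂ) ⊗ₖ densityMatrix ξ) * choi G =
        (ρᵀ ⊗ₖ (1 : Matrix (Fin n) (Fin n) ℂ)) * choi (hsDual F) ↔
      ((1 : Matrix (Fin m) (Fin m) ℂ) ⊗ₖ supportProj ξ) * choi G =
          (ρᵀ ⊗ₖ pinv (densityMatrix ξ)) * choi (hsDual F) := by
    constructor
    · intro h
      rw [← pinv_densityMatrix_mul hσs, ← one_kronecker_mul, Matrix.mul_assoc, h,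
        ← Matrix.mul_assoc, ← Matrix.mul_kronecker_mul, Matrix.one_mul, Matrix.mul_one]
    · intro h
      -- Multiplying back by `σ` only recovers `P F*(ρA)`; the missing part `(1 - P) F*(ρA)`
      -- vanishes because `(1 - P) σ = 0`.
      have h0 := kronecker_mul_choi_hsDual_eq_zero hF hρ
        (isStarProjection_supportProj ξ).one_sub (by
          rw [← hσ, Matrix.sub_mul, Matrix.one_mul, ← pinv_densityMatrix_mul hσs,
            pinv_mul_comm hσs, (pinv_spec _).mul_mul_self, sub_self])
      rw [← densityMatrix_mul_supportProj, ← one_kronecker_mul, Matrix.mul_assoc, h,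
        ← Matrix.mul_assoc, ← Matrix.mul_kronecker_mul, Matrix.one_mul,
        densityMatrix_mul_pinv hσs]
      rw [kronecker_one_sub, Matrix.sub_mul, sub_eq_zero] at h0
      exact h0.symm
  constructor
  · rintro ⟨⟨h1, h2⟩, h3⟩
    exact ⟨(isCompletelyPositive_iff_choi G).1 h1, by rw [partialTrace_choi, h2],
      hsupp.1 (hbayes.1 h3)⟩
  · rintro ⟨h1, h2, h3⟩
    exact ⟨⟨(isCompletelyPositive_iff_choi G).2 h1, by rw [← partialTrace_choi, h2]⟩,
      hbayes.2 (hsupp.2 h3)⟩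

end Bayes

/-! ### Completions of a partial Choi matrix -/

section Completion

variable {m n : ℕ}

/-- Identifies the block form of the completion with zero Schur complement; the range condition and
its adjoint simplify the cross terms. -/
theorem conjTranspose_mul_pinv_mul {ι : Type*} [Fintype ι] [DecidableEq ι] {T Q : Matrix ι ι ℂ}
    (hA : (T * Q)ᴴ = T * Q)
    (hB : T * Q * pinv (T * Q) * (T * (1 - Q)) = T * (1 - Q)) :
    Tᴴ * pinv (T * Q) * T =
      T + (T * (1 - Q))ᴴ + (T * (1 - Q))ᴴ * pinv (T * Q) * (T * (1 - Q)) := by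
  have hT : T = T * Q + T * (1 - Q) := by rw [← Matrix.mul_add]; simp
  set A := T * Q
  set B := T * (1 - Q)
  clear_value A B
  have hB' : Bᴴ * pinv A * A = Bᴴ := by
    have := congrArg conjTranspose hB
    rwa [conjTranspose_mul, conjTranspose_mul, conjTranspose_pinv hA, hA, ← Matrix.mul_assoc]
      at this
  have h1 := (pinv_spec A).mul_mul_self
  calc Tᴴ * pinv A * T = (A + B)ᴴ * pinv A * (A + B) := by rw [← hT]
    _ = A * pinv A * A + A * pinv A * B + (Bᴴ * pinv A * A + Bᴴ * pinv A * B) := by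
      rw [conjTranspose_add, hA, Matrix.add_mul, Matrix.add_mul, Matrix.mul_add, Matrix.mul_add]
    _ = A + B + Bᴴ + Bᴴ * pinv A * B := by rw [h1, hB, hB', ← add_assoc]
    _ = T + Bᴴ + Bᴴ * pinv A * B := by rw [← hT]

/-- The Schur complement condition is necessary. -/
theorem partialTrace_le_of_completion {C T : Matrix (Fin m × Fin n) (Fin m × Fin n) ℂ}
    {P : Matrix (Fin n) (Fin n) ℂ} (hP : IsStarProjection P) (hC : C.PosSemidef)
    (hC1 : partialTrace C = 1) (hT : ((1 : Matrix (Fin m) (Fin m) ℂ) ⊗ₖ P) * C = T) :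
    (T * 1 ⊗ₖ P)ᴴ = T * 1 ⊗ₖ P ∧
      partialTrace ((T * 1 ⊗ₖ (1 - P))ᴴ * pinv (T * 1 ⊗ₖ P) * (T * 1 ⊗ₖ (1 - P))) ≤ 1 - P := by
  have hQ := isStarProjection_one_kronecker (m := m) hP
  have hs := posSemidef_partialTrace (posSemidef_schur_compl hC hQ)
  have hQs : ((1 : Matrix (Fin m) (Fin m) ℂ) ⊗ₖ P)ᴴ = 1 ⊗ₖ P := hQ.isSelfAdjoint
  constructor
  · rw [← hT]
    simp only [conjTranspose_mul, hQs, hC.isHermitian.eq, Matrix.mul_assoc]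
  · rw [partialTrace_sub, hT, ← one_kronecker_one_sub, partialTrace_mul_one_kronecker,
      partialTrace_one_kronecker_mul, hC1, Matrix.mul_one, hP.one_sub.isIdempotentElem.eq] at hs
    exact hs

/-- Equality makes the positive Schur complement traceless, hence zero, which fixes the only block
not prescribed by `T`. -/
theorem completion_unique {C T : Matrix (Fin m × Fin n) (Fin m × Fin n) ℂ}
    {P : Matrix (Fin n) (Fin n) ℂ} (hP : IsStarProjection P) (hC : C.PosSemidef)
    (hC1 : partialTrace C = 1) (hT : ((1 : Matrix (Fin m) (Fin m) ℂ) ⊗ₖ P) * C = T)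
    (h : partialTrace ((T * 1 ⊗ₖ (1 - P))ᴴ * pinv (T * 1 ⊗ₖ P) * (T * 1 ⊗ₖ (1 - P))) = 1 - P) :
    C = T + (T * 1 ⊗ₖ (1 - P))ᴴ +
      (T * 1 ⊗ₖ (1 - P))ᴴ * pinv (T * 1 ⊗ₖ P) * (T * 1 ⊗ₖ (1 - P)) := by
  have hQ := isStarProjection_one_kronecker (m := m) hP
  have hs := posSemidef_schur_compl hC hQ
  have h0 := hs.trace_eq_zero_iff.1 (by
    rw [← trace_partialTrace, partialTrace_sub, hT, ← one_kronecker_one_sub, h,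
      partialTrace_mul_one_kronecker, partialTrace_one_kronecker_mul, hC1, Matrix.mul_one,
      hP.one_sub.isIdempotentElem.eq, sub_self, Matrix.trace_zero])
  rw [hT, ← one_kronecker_one_sub, sub_eq_zero] at h0
  have hQs : ((1 : Matrix (Fin m) (Fin m) ℂ) ⊗ₖ P)ᴴ = 1 ⊗ₖ P := hQ.isSelfAdjoint
  have hQs' := conjTranspose_one_sub_of_isStarProjection hQ
  rw [← one_kronecker_one_sub] at hQs'
  have hB : (T * 1 ⊗ₖ (1 - P))ᴴ = 1 ⊗ₖ (1 - P) * C * 1 ⊗ₖ P := by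
    rw [← hT, conjTranspose_mul, conjTranspose_mul, hQs, hQs', hC.isHermitian.eq, Matrix.mul_assoc]
  rw [← h0, hB, ← hT, one_kronecker_one_sub]
  simp only [Matrix.mul_sub, Matrix.sub_mul, Matrix.mul_one, Matrix.one_mul]
  abel

theorem exists_completion [NeZero m] {K M : Matrix (Fin m × Fin n) (Fin m × Fin n) ℂ}
    {P : Matrix (Fin n) (Fin n) ℂ} (hP : IsStarProjection P) (hK : K.PosSemidef)
    (hM : M.PosSemidef) (hKP : K * 1 ⊗ₖ P = K) (htr : partialTrace (K * M) = P)
    (hA : (K * M * 1 ⊗ₖ P)ᴴ = K * M * 1 ⊗ₖ P)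
    (hle : partialTrace ((K * M * 1 ⊗ₖ (1 - P))ᴴ * pinv (K * M * 1 ⊗ₖ P) *
      (K * M * 1 ⊗ₖ (1 - P))) ≤ 1 - P) :
    ∃ C : Matrix (Fin m × Fin n) (Fin m × Fin n) ℂ, C.PosSemidef ∧ partialTrace C = 1 ∧
      ((1 : Matrix (Fin m) (Fin m) ℂ) ⊗ₖ P) * C = K * M := by
  have hQ := isStarProjection_one_kronecker (m := m) hP
  have hApos := posSemidef_mul_mul_proj hK hM hQ hKP hA
  have hAB := mul_pinv_mul_offDiag hK hM hQ hKP hA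
  have hQs : ((1 : Matrix (Fin m) (Fin m) ℂ) ⊗ₖ P)ᴴ = 1 ⊗ₖ P := hQ.isSelfAdjoint
  have hcomp := conjTranspose_mul_pinv_mul hA hAB
  rw [← one_kronecker_one_sub] at hcomp hAB
  set T := K * M with hT
  clear_value T
  set B := T * 1 ⊗ₖ (1 - P) with hB
  set A := T * 1 ⊗ₖ P with hAdef
  clear_value A B
  -- The deficit of the partial trace: since `B` has partial trace zero, that of `Tᴴ * pinv A * T`
  -- is `1 - E`.
  set E := 1 - P - partialTrace (Bᴴ * pinv A * B) with hE
  have hPB : partialTrace B = 0 := by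
    rw [hB, partialTrace_mul_one_kronecker, htr, hP.mul_one_sub_self]
  have hBP : B * 1 ⊗ₖ P = 0 := by
    rw [hB, Matrix.mul_assoc, one_kronecker_mul, hP.one_sub_mul_self, Matrix.kronecker_zero,
      Matrix.mul_zero]
  have hPE : P * E = 0 := by
    have hPB' : (1 : Matrix (Fin m) (Fin m) ℂ) ⊗ₖ P * Bᴴ = 0 := by
      have := congrArg conjTranspose hBP
      rwa [conjTranspose_mul, hQs, conjTranspose_zero] at this
    rw [hE, Matrix.mul_sub, hP.mul_one_sub_self, ← partialTrace_one_kronecker_mul,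
      ← Matrix.mul_assoc, ← Matrix.mul_assoc, hPB']
    ext; simp [partialTrace]
  have hm : (m : ℂ) ≠ 0 := Nat.cast_ne_zero.2 (NeZero.ne m)
  -- The factor `1/m` offsets `tr 1 = m`, so the second term contributes exactly `E`; `P * E = 0`
  -- keeps it out of the prescribed row.
  refine ⟨Tᴴ * pinv A * T + (m : ℂ)⁻¹ • ((1 : Matrix (Fin m) (Fin m) ℂ) ⊗ₖ E), ?_, ?_, ?_⟩
  · refine ((posSemidef_pinv hApos).conjTranspose_mul_mul_same T).add ?_
    refine (PosSemidef.one.kronecker hle).smul ?_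
    rw [← Complex.ofReal_natCast, ← Complex.ofReal_inv]
    exact Complex.zero_le_real.2 (by positivity)
  · rw [partialTrace_add, hcomp, partialTrace_add, partialTrace_add, partialTrace_conjTranspose,
      hPB, htr, partialTrace_smul, partialTrace_kronecker, Matrix.trace_one, Fintype.card_fin,
      smul_smul, inv_mul_cancel₀ hm, one_smul, conjTranspose_zero, hE]
    abel
  · have hQT : (1 : Matrix (Fin m) (Fin m) ℂ) ⊗ₖ P * Tᴴ = A := by
      rw [← hA, hAdef, conjTranspose_mul, hQs]
    have hTAB : T = A + B := by
      rw [hAdef, hB, one_kronecker_one_sub, ← Matrix.mul_add, add_sub_cancel, Matrix.mul_one]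
    rw [Matrix.mul_add, Matrix.mul_smul, one_kronecker_mul, hPE, Matrix.kronecker_zero, smul_zero,
      add_zero, ← Matrix.mul_assoc, ← Matrix.mul_assoc, hQT]
    calc A * pinv A * T = A * pinv A * (A + B) := by rw [← hTAB]
      _ = A + B := by rw [Matrix.mul_add, (pinv_spec A).mul_mul_self, hAB]
      _ = T := hTAB.symm

end Completion

end MatrixBayes

/-! ### Existence and uniqueness of Bayesian inverses -/

theorem mainTheorem1 {m n : ℕ}
    (F : Matrix (Fin n) (Fin n) ℂ →ₗ[ℂ] Matrix (Fin m) (Fin m) ℂ) (hF : IsCPU F)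
    (ρ : Matrix (Fin m) (Fin m) ℂ) (hρ : IsDensityMatrix ρ) :
    let ω : Matrix (Fin m) (Fin m) ℂ →ₗ[ℂ] ℂ := traceFunctional ρ
    let ξ : Matrix (Fin n) (Fin n) ℂ →ₗ[ℂ] ℂ := ω ∘ₗ F
    let σ : Matrix (Fin n) (Fin n) ℂ := densityMatrix ξ
    let P : Matrix (Fin n) (Fin n) ℂ := supportProj ξ
    let 𝔄 : Matrix (Fin m × Fin n) (Fin m × Fin n) ℂ :=
      ∑ i : Fin m, ∑ j : Fin m,
        Matrix.single i j (1 : ℂ) ⊗ₖ (pinv σ * hsDual F (ρ * Matrix.single i j (1 : ℂ)) * P)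
    let 𝔅 : Matrix (Fin m × Fin n) (Fin m × Fin n) ℂ :=
      ∑ i : Fin m, ∑ j : Fin m,
        Matrix.single i j (1 : ℂ) ⊗ₖ (pinv σ * hsDual F (ρ * Matrix.single i j (1 : ℂ)) * (1 - P))
    -- existence
    ((∃ G, IsBayesianInverse F ω G) ↔
      (𝔄ᴴ = 𝔄 ∧ partialTrace (𝔅ᴴ * pinv 𝔄 * 𝔅) ≤ 1 - P)) ∧
    -- uniqueness in the case of equality
    (𝔄ᴴ = 𝔄 → partialTrace (𝔅ᴴ * pinv 𝔄 * 𝔅) = 1 - P → ∃! G, IsBayesianInverse F ω G) ∧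
    -- almost everywhere uniqueness in general
    (∀ G G', IsBayesianInverse F ω G → IsBayesianInverse F ω G' → AEEquivalent ξ G G') := by

  intro ω ξ σ P 𝔄 𝔅
  -- A matrix of size zero has trace `0`, not `1`.
  have hm : NeZero m := ⟨by
    rintro rfl
    simpa [Matrix.trace] using hρ.trace_eq_one⟩
  have hFc := hF.completelyPositive
  have hσ : σ.PosSemidef := posSemidef_hsDual hFc hρ.posSemidef
  have hσs : σᴴ = σ := hσ.isHermitian.eq
  have hP : IsStarProjection P := isStarProjection_supportProj ξ
  have hQ := isStarProjection_one_kronecker (m := m) hP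
  have hM := posSemidef_choi_hsDual hFc
  set M := choi (hsDual F) with hMdef
  set K := ρᵀ ⊗ₖ pinv σ with hKdef
  have hK : K.PosSemidef := hρ.posSemidef.transpose.kronecker (posSemidef_pinv hσ)
  have hKP : K * 1 ⊗ₖ P = K := by
    rw [hKdef, ← Matrix.mul_kronecker_mul, Matrix.mul_one, pinv_densityMatrix_mul_supportProj hσs]
  have hblock : ∀ R : Matrix (Fin n) (Fin n) ℂ,
      ∑ i : Fin m, ∑ j : Fin m, Matrix.single i j (1 : ℂ) ⊗ₖ
        (pinv σ * hsDual F (ρ * Matrix.single i j (1 : ℂ)) * R) = K * M * 1 ⊗ₖ R := by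
    intro R
    have := sum_single_kronecker_eq_choi (LinearMap.mulRight ℂ R ∘ₗ LinearMap.mulLeft ℂ (pinv σ) ∘ₗ
      hsDual F ∘ₗ LinearMap.mulLeft ℂ ρ)
    rw [choi_mulRight_comp, choi_mulLeft_comp, choi_comp_mulLeft, ← Matrix.mul_assoc,
      ← Matrix.mul_kronecker_mul, Matrix.one_mul, Matrix.mul_one] at this
    exact this
  have htr : partialTrace (K * M) = P := by
    have e : K = ((1 : Matrix (Fin m) (Fin m) ℂ) ⊗ₖ pinv σ) * (ρᵀ ⊗ₖ 1) := by
      rw [← Matrix.mul_kronecker_mul, Matrix.one_mul, Matrix.mul_one]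
    rw [e, Matrix.mul_assoc, partialTrace_one_kronecker_mul, partialTrace_kronecker_mul_choi_hsDual]
    exact pinv_densityMatrix_mul hσs
  have h𝔄 : 𝔄 = K * M * 1 ⊗ₖ P := hblock P
  have h𝔅 : 𝔅 = K * M * 1 ⊗ₖ (1 - P) := hblock (1 - P)
  have hiff : ∀ G, IsBayesianInverse F ω G ↔ (choi G).PosSemidef ∧ partialTrace (choi G) = 1 ∧
      ((1 : Matrix (Fin m) (Fin m) ℂ) ⊗ₖ P) * choi G = K * M :=
    isBayesianInverse_iff_choi hFc hρ.posSemidef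
  have hex : 𝔄ᴴ = 𝔄 → partialTrace (𝔅ᴴ * pinv 𝔄 * 𝔅) ≤ 1 - P → ∃ G, IsBayesianInverse F ω G := by
    rw [h𝔄, h𝔅]
    intro h1 h2
    obtain ⟨C, hC⟩ := exists_completion hP hK hM hKP htr h1 h2
    exact ⟨ofChoi C, (hiff _).2 (by rwa [choi_ofChoi])⟩
  refine ⟨⟨?_, fun h => hex h.1 h.2⟩, ?_, ?_⟩
  · rintro ⟨G, hG⟩
    obtain ⟨h1, h2, h3⟩ := (hiff G).1 hG
    rw [h𝔄, h𝔅]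
    exact partialTrace_le_of_completion hP h1 h2 h3
  · intro h1 h2
    refine existsUnique_of_exists_of_unique (hex h1 h2.le) fun G G' hG hG' => ?_
    rw [h𝔄, h𝔅] at h2
    obtain ⟨c1, c2, c3⟩ := (hiff G).1 hG
    obtain ⟨d1, d2, d3⟩ := (hiff G').1 hG'
    exact choi_injective ((completion_unique hP c1 c2 c3 h2).trans
      (completion_unique hP d1 d2 d3 h2).symm)
  · intro G G' hG hG' B A
    obtain ⟨c1, -, c3⟩ := (hiff G).1 hG
    obtain ⟨d1, -, d3⟩ := (hiff G').1 hG'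
    have hQs : ((1 : Matrix (Fin m) (Fin m) ℂ) ⊗ₖ P)ᴴ = 1 ⊗ₖ P := hQ.isSelfAdjoint
    -- The Choi matrices agree after left multiplication by `Q`; as they are Hermitian, also after
    -- right multiplication, the side on which `ξ(B G(A))` absorbs `P`.
    have h := congrArg Matrix.conjTranspose (c3.trans d3.symm)
    rw [Matrix.conjTranspose_mul, Matrix.conjTranspose_mul, hQs, c1.isHermitian.eq,
      d1.isHermitian.eq, ← choi_mulRight_comp, ← choi_mulRight_comp] at h
    have hA : G A * P = G' A * P := LinearMap.congr_fun (choi_injective h) A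
    have hξ : ∀ X, ξ X = ξ (X * P) := fun X => (((supportProj_spec ξ).1.2 X).2.1).symm
    rw [hξ, hξ (B * G' A), Matrix.mul_assoc, hA, Matrix.mul_assoc]
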